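/- **Theorem (LOCC Haar indistinguishability).** For $n\ge 0$ let $\mathcal H_n$ be the Haar distribution on $n$-qubit pure states, i.e. the unitarily invariant probability measure on the unit sphere of $(\mathbb C^2)^{\otimes n}\cong\mathbb C^{2^n}$. For integers $n,t\ge 0$ define the bipartite density matrices $$\rho_{AB}^{(n,t)} := \mathbb E_{|\psi\rangle\leftarrow\mathcal H_n}\Big[\,|\psi\rangle\langle\psi|^{\otimes t}_{A}\otimes|\psi\rangle\langle\psi|^{\otimes t}_{B}\Big],\qquad \sigma_{AB}^{(n,t)} := \mathbb E_{|\psi\rangle\leftarrow\mathcal H_n}\Big[\,|\psi\rangle\langle\psi|^{\otimes t}_{A}\Big]\otimes\mathbb E_{|\phi\rangle\leftarrow\mathcal H_n}\Big[\,|\phi\rangle\langle\phi|^{\otimes t}_{B}\Big].$$ An LOCC adversary $(A,B)$ is a finite two-party protocol without shared entanglement, in which Alice initially holds register $A$ and Bob register $B$: in each step one of the parties applies a quantum instrument with finitely many classical outcomes to its own register (possibly changing the register to another finite-dimensional one) and announces the outcome to the other party; who acts next and what is done may depend on all previous outcomes; at the end Bob performs a two-outcome measurement and outputs a bit. The parties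 are computationally unbounded. Then $\rho_{AB}^{(n,t)}$ and $\sigma_{AB}^{(n,t)}$ are $O(t^2/2^n)$-LOCC indistinguishable: there is an absolute constant $C>0$ such that for all integers $n,t\ge 0$ and every LOCC adversary $(A,B)$, $$\Big|\Pr\big[(A,B)(\rho_{AB}^{(n,t)})=1\big]-\Pr\big[(A,B)(\sigma_{AB}^{(n,t)})=1\big]\Big|\le C\cdot\frac{t^2}{2^n}.$$ -/

import Mathlib

noncomputable section

namespace LOCCHaar

open MeasureTheory Matrix
open scoped Kronecker ComplexOrder

/-- Labels of the computational basis of `n` qubits, that is, `n`-bit strings. -/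
abbrev Bits (n : ℕ) : Type := Fin n → Fin 2

/-- Pure `n`-qubit states: unit vectors of `ℂ^(2^n)`. -/
abbrev PureState (n : ℕ) : Type :=
  Metric.sphere (0 : EuclideanSpace ℂ (Bits n)) 1

/-- The Haar distribution on `n`-qubit pure states: the normalized rotation-invariant surface
measure on the unit sphere of `ℂ^(2^n)`. -/
def haarState (n : ℕ) : Measure (PureState n) :=
  ((volume : Measure (EuclideanSpace ℂ (Bits n))).toSphere Set.univ)⁻¹ •
    (volume : Measure (EuclideanSpace ℂ (Bits n))).toSphere

instance (n : ℕ) : IsProbabilityMeasure (haarState n) := by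
  refine ⟨?_⟩
  have h0 : (volume : Measure (EuclideanSpace ℂ (Bits n))).toSphere Set.univ ≠ 0 := by
    rw [Ne, Measure.measure_univ_eq_zero]
    exact Measure.toSphere_ne_zero _
  rw [haarState, Measure.smul_apply, smul_eq_mul]
  exact ENNReal.inv_mul_cancel h0 (measure_ne_top _ _)

open scoped Pointwise in
/-- The Haar distribution is invariant under all unitary maps. -/
theorem map_haarState (n : ℕ)
    (U : EuclideanSpace ℂ (Bits n) ≃ₗᵢ[ℂ] EuclideanSpace ℂ (Bits n)) :
    (haarState n).map (fun ψ : PureState n => (⟨U ψ.1, by simp⟩ : PureState n)) = haarState n := by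
  have hm : Measurable (fun ψ : PureState n => (⟨U ψ.1, by simp⟩ : PureState n)) :=
    (Continuous.subtype_mk (U.continuous.comp continuous_subtype_val) _).measurable
  have hU : MeasurePreserving (U : EuclideanSpace ℂ (Bits n) → _) volume volume :=
    LinearIsometryEquiv.measurePreserving
      ({ toLinearEquiv := U.toLinearEquiv.restrictScalars ℝ, norm_map' := U.norm_map } :
        EuclideanSpace ℂ (Bits n) ≃ₗᵢ[ℝ] EuclideanSpace ℂ (Bits n))
  ext s hs
  rw [Measure.map_apply hm hs, haarState, Measure.smul_apply, Measure.smul_apply,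
    Measure.toSphere_apply' _ hs, Measure.toSphere_apply' _ (hm hs)]
  congr 2
  symm
  rw [← hU.measure_preimage_emb U.toHomeomorph.measurableEmbedding]
  congr 1
  ext x
  simp only [Set.mem_smul, Set.mem_image, Set.mem_preimage]
  constructor
  · rintro ⟨r, hr, y, ⟨ψ, hψ, rfl⟩, h⟩
    refine ⟨r, hr, U.symm ψ.1, ⟨⟨U.symm ψ.1, by simp⟩, by simpa using hψ, rfl⟩, ?_⟩
    apply U.injective
    rw [← h]
    exact (U.toLinearEquiv.map_smul_of_tower r _).trans
      (congrArg (r • ·) (U.apply_symm_apply ψ.1))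
  · rintro ⟨r, hr, y, ⟨ψ, hψ, rfl⟩, rfl⟩
    exact ⟨r, hr, _, ⟨_, hψ, rfl⟩, (U.toLinearEquiv.map_smul_of_tower r ψ.1).symm⟩

/-- The density matrix `|ψ⟩⟨ψ|` of a pure state. -/
def ketbra {n : ℕ} (ψ : PureState n) : Matrix (Bits n) (Bits n) ℂ :=
  vecMulVec (fun x => ψ.1 x) (star fun x => ψ.1 x)

/-- The tensor power `M^{⊗t}`, in the product basis of `t` registers. -/
def tensorPow {ι : Type} (t : ℕ) (M : Matrix ι ι ℂ) : Matrix (Fin t → ι) (Fin t → ι) ℂ :=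
  of fun x y => ∏ i, M (x i) (y i)

/-- Entrywise expectation of a random matrix. -/
def matrixExp {Ω κ : Type} [MeasurableSpace Ω] (μ : Measure Ω) (F : Ω → Matrix κ κ ℂ) :
    Matrix κ κ ℂ :=
  of fun x y => ∫ ω, F ω x y ∂μ

/-- A register holding `t` blocks of `n` qubits each. -/
abbrev Reg (n t : ℕ) : Type := Fin t → Bits n

/-- `ρ_AB = E_ψ [ |ψ⟩⟨ψ|^{⊗t}_A ⊗ |ψ⟩⟨ψ|^{⊗t}_B ]`: `t` copies each of the same Haar state. -/
def identicalHaar (n t : ℕ) : Matrix (Reg n t × Reg n t) (Reg n t × Reg n t) ℂ :=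
  matrixExp (haarState n) fun ψ => tensorPow t (ketbra ψ) ⊗ₖ tensorPow t (ketbra ψ)

/-- `σ_AB = E_ψ [ |ψ⟩⟨ψ|^{⊗t}_A ] ⊗ E_φ [ |φ⟩⟨φ|^{⊗t}_B ]`: `t` copies each of two independent
Haar states. -/
def independentHaar (n t : ℕ) : Matrix (Reg n t × Reg n t) (Reg n t × Reg n t) ℂ :=
  matrixExp (haarState n) (fun ψ => tensorPow t (ketbra ψ)) ⊗ₖ
    matrixExp (haarState n) (fun φ => tensorPow t (ketbra φ))

/-- A quantum instrument from a register with basis `α` to a register with basis `α'` with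
classical outcomes in `ι`, in Kraus form: on outcome `m` the (unnormalized) state becomes
`∑ j, K_{m,j} X K_{m,j}†`, and the sum over all outcomes is trace preserving.
The index `j` is not observed, so these are all the instruments with outcomes in `ι`. -/
structure Instrument (ι α α' : Type) [Fintype ι] [Fintype α] [DecidableEq α] [Fintype α'] where
  /-- number of Kraus operators for each outcome (some may be zero) -/
  numKraus : ℕ
  /-- the Kraus operators -/
  kraus : ι → Fin numKraus → Matrix α' α ℂ
  complete : ∑ m, ∑ j, (kraus m j)ᴴ * kraus m j = 1

/-- Finite two-party protocols with local operations and classical communication. `LOCC α β` is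
the type of (remaining) protocols when Alice holds a register with basis `α` and Bob one with
basis `β`. A protocol is a finite tree: at a node one party applies an instrument to its own
register, possibly changing it (adding an ancilla, discarding part of it, keeping private
memory), and announces the outcome, on which everything that follows may depend. At a leaf, Bob
measures `{E, 1 - E}` and outputs `1` on the outcome `E`. -/
inductive LOCC : (α β : Type) → [Fintype α] → [DecidableEq α] → [Fintype β] → [DecidableEq β] →
    Type 1
  | output {α β : Type} [Fintype α] [DecidableEq α] [Fintype β] [DecidableEq β]
      (E : Matrix β β ℂ) (nonneg : E.PosSemidef) (le_one : (1 - E).PosSemidef) : LOCC α β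
  | alice {α β α' ι : Type} [Fintype α] [DecidableEq α] [Fintype β] [DecidableEq β]
      [Fintype α'] [DecidableEq α'] [Fintype ι]
      (I : Instrument ι α α') (next : ι → LOCC α' β) : LOCC α β
  | bob {α β β' ι : Type} [Fintype α] [DecidableEq α] [Fintype β] [DecidableEq β]
      [Fintype β'] [DecidableEq β'] [Fintype ι]
      (I : Instrument ι β β') (next : ι → LOCC α β') : LOCC α β

/-- The unnormalized joint state after Alice's instrument gave outcome `m`. -/
def Instrument.onAlice {ι α α' β : Type} [Fintype ι] [Fintype α] [DecidableEq α] [Fintype α']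
    [Fintype β] [DecidableEq β] (I : Instrument ι α α') (m : ι)
    (ρ : Matrix (α × β) (α × β) ℂ) : Matrix (α' × β) (α' × β) ℂ :=
  ∑ j, (I.kraus m j ⊗ₖ (1 : Matrix β β ℂ)) * ρ * (I.kraus m j ⊗ₖ (1 : Matrix β β ℂ))ᴴ

/-- The unnormalized joint state after Bob's instrument gave outcome `m`. -/
def Instrument.onBob {ι α β β' : Type} [Fintype ι] [Fintype β] [DecidableEq β] [Fintype β']
    [Fintype α] [DecidableEq α] (I : Instrument ι β β') (m : ι)
    (ρ : Matrix (α × β) (α × β) ℂ) : Matrix (α × β') (α × β') ℂ :=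
  ∑ j, ((1 : Matrix α α ℂ) ⊗ₖ I.kraus m j) * ρ * ((1 : Matrix α α ℂ) ⊗ₖ I.kraus m j)ᴴ

/-- `Pr[(A,B)(ρ) = 1]`. As states along the tree are unnormalized (their trace is the probability
of the transcript), the probability is the sum over all transcripts of `Tr((1 ⊗ E) ρ)`. -/
def LOCC.prob : {α β : Type} → [Fintype α] → [DecidableEq α] → [Fintype β] → [DecidableEq β] →
    LOCC α β → Matrix (α × β) (α × β) ℂ → ℝ
  | _, _, _, _, _, _, @LOCC.output α _ _ _ _ _ E _ _, ρ =>
    (((1 : Matrix α α ℂ) ⊗ₖ E) * ρ).trace.re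
  | _, _, _, _, _, _, @LOCC.alice _ _ _ _ _ _ _ _ _ _ _ I next, ρ =>
    ∑ m, (next m).prob (I.onAlice m ρ)
  | _, _, _, _, _, _, @LOCC.bob _ _ _ _ _ _ _ _ _ _ _ I next, ρ =>
    ∑ m, (next m).prob (I.onBob m ρ)

/-- `ε`-LOCC indistinguishability of two bipartite states. -/
def LOCCIndistinguishable {α β : Type} [Fintype α] [DecidableEq α] [Fintype β] [DecidableEq β]
    (ε : ℝ) (ρ σ : Matrix (α × β) (α × β) ℂ) : Prop :=
  ∀ P : LOCC α β, |P.prob ρ - P.prob σ| ≤ ε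

end LOCCHaar

end

/-! Put `d = 2 ^ n` and `ε = t ^ 2 / d`. A joint measurement may separate the two states, so
closeness of `ρ` and `σ` in trace distance is not available. What holds is one-sided domination on
product effects: `Tr((A ⊗ B) ρ) ≥ (1 - ε) Tr((A ⊗ B) σ)` for positive semidefinite `A`, `B`. Every
acceptance or rejection effect of an LOCC protocol is a sum of such products, so `P(ρ) - (1 - ε)
P(σ)` lies between `0` and its trace bound `ε`, whence `|P(ρ) - P(σ)| ≤ ε`
(`LOCCIndistinguishable.of_blockPos`).

For the domination write `A = Cᴴ * C`. Then `Tr(A |ψ⟩⟨ψ|^{⊗t})` is a sum of `|p(ψ)|²`, with `p`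
homogeneous of degree `t` in the amplitudes. Haar moments turn `E|p|²` into a weight `w(deg p)`
times the Fock norm, in which monomials `z^α` are orthogonal with squared norm `α!`. Bombieri's
inequality `‖p q‖² ≥ ‖p‖² ‖q‖²` (`bombieri`) gives `E[|p|² |q|²] ≥ (w(2t) / w(t)²) E|p|² E|q|²`, and
this ratio of weights is `∏_{i<t} (d + i) / (d + t + i) ≥ 1 - t² / d` (`haarWeight_two_mul`). -/

noncomputable section

namespace LOCCHaar

open MeasureTheory Matrix
open scoped Kronecker ComplexOrder

/-! ### LOCC protocols and product effects -/

section Protocols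

/-- Nonnegativity of a bipartite matrix on all products of positive semidefinite effects. -/
def BlockPos {α β : Type} [Fintype α] [Fintype β] (D : Matrix (α × β) (α × β) ℂ) : Prop :=
  ∀ (A : Matrix α α ℂ) (B : Matrix β β ℂ), A.PosSemidef → B.PosSemidef →
    0 ≤ ((A ⊗ₖ B) * D).trace.re

variable {ι α α' β β' : Type} [Fintype ι] [Fintype α] [DecidableEq α] [Fintype α']
  [Fintype β] [DecidableEq β] [Fintype β']

/-- Heisenberg picture: Kraus operators act on the effect instead of the state. The pulled-back
effect is again a sum of products of positive semidefinite matrices, which is why `BlockPos`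
survives every round. -/
theorem trace_mul_onAlice (I : Instrument ι α α') (m : ι) (A : Matrix α' α' ℂ)
    (B : Matrix β β ℂ) (D : Matrix (α × β) (α × β) ℂ) :
    ((A ⊗ₖ B) * I.onAlice m D).trace =
      ∑ j, ((((I.kraus m j)ᴴ * A * I.kraus m j) ⊗ₖ B) * D).trace := by
  simp only [Instrument.onAlice, Matrix.mul_sum, trace_sum]
  refine Finset.sum_congr rfl fun j _ => ?_
  rw [← Matrix.mul_assoc, trace_mul_comm, ← Matrix.mul_assoc, ← Matrix.mul_assoc,
    conjTranspose_kronecker, ← mul_kronecker_mul, ← mul_kronecker_mul]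
  simp

theorem trace_mul_onBob (I : Instrument ι β β') (m : ι) (A : Matrix α α ℂ)
    (B : Matrix β' β' ℂ) (D : Matrix (α × β) (α × β) ℂ) :
    ((A ⊗ₖ B) * I.onBob m D).trace =
      ∑ j, ((A ⊗ₖ ((I.kraus m j)ᴴ * B * I.kraus m j)) * D).trace := by
  simp only [Instrument.onBob, Matrix.mul_sum, trace_sum]
  refine Finset.sum_congr rfl fun j _ => ?_
  rw [← Matrix.mul_assoc, trace_mul_comm, ← Matrix.mul_assoc, ← Matrix.mul_assoc,
    conjTranspose_kronecker, ← mul_kronecker_mul, ← mul_kronecker_mul]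
  simp

theorem sum_trace_onAlice [DecidableEq α'] (I : Instrument ι α α') (D : Matrix (α × β) (α × β) ℂ) :
    ∑ m, (I.onAlice m D).trace = D.trace := by
  have h : ∀ m, (I.onAlice m D).trace =
      ∑ j, ((((I.kraus m j)ᴴ * I.kraus m j) ⊗ₖ (1 : Matrix β β ℂ)) * D).trace := fun m => by
    simpa using trace_mul_onAlice I m 1 1 D
  simp_rw [h, ← trace_sum, ← Matrix.sum_mul]
  have hk : ∑ m, ∑ j, ((I.kraus m j)ᴴ * I.kraus m j) ⊗ₖ (1 : Matrix β β ℂ) = 1 := by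
    rw [← one_kronecker_one, ← I.complete]
    ext ⟨a, b⟩ ⟨a', b'⟩
    simp [Matrix.sum_apply, Finset.sum_mul]
  rw [hk, Matrix.one_mul]

theorem sum_trace_onBob [DecidableEq β'] (I : Instrument ι β β') (D : Matrix (α × β) (α × β) ℂ) :
    ∑ m, (I.onBob m D).trace = D.trace := by
  have h : ∀ m, (I.onBob m D).trace =
      ∑ j, (((1 : Matrix α α ℂ) ⊗ₖ ((I.kraus m j)ᴴ * I.kraus m j)) * D).trace := fun m => by
    simpa using trace_mul_onBob I m 1 1 D
  simp_rw [h, ← trace_sum, ← Matrix.sum_mul]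
  have hk : ∑ m, ∑ j, (1 : Matrix α α ℂ) ⊗ₖ ((I.kraus m j)ᴴ * I.kraus m j) = 1 := by
    rw [← one_kronecker_one, ← I.complete]
    ext ⟨a, b⟩ ⟨a', b'⟩
    simp [Matrix.sum_apply, Finset.mul_sum]
  rw [hk, Matrix.one_mul]

theorem BlockPos.onAlice {D : Matrix (α × β) (α × β) ℂ} (hD : BlockPos D)
    (I : Instrument ι α α') (m : ι) : BlockPos (I.onAlice m D) := by
  intro A B hA hB
  rw [trace_mul_onAlice, Complex.re_sum]
  exact Finset.sum_nonneg fun j _ => hD _ _ (hA.conjTranspose_mul_mul_same _) hB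

theorem BlockPos.onBob {D : Matrix (α × β) (α × β) ℂ} (hD : BlockPos D)
    (I : Instrument ι β β') (m : ι) : BlockPos (I.onBob m D) := by
  intro A B hA hB
  rw [trace_mul_onBob, Complex.re_sum]
  exact Finset.sum_nonneg fun j _ => hD _ _ hA (hB.conjTranspose_mul_mul_same _)

theorem Instrument.onAlice_sub_smul (I : Instrument ι α α') (m : ι) (c : ℝ)
    (ρ σ : Matrix (α × β) (α × β) ℂ) :
    I.onAlice m (ρ - c • σ) = I.onAlice m ρ - c • I.onAlice m σ := by
  simp [Instrument.onAlice, Matrix.mul_sub, Matrix.sub_mul, Finset.smul_sum]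

theorem Instrument.onBob_sub_smul (I : Instrument ι β β') (m : ι) (c : ℝ)
    (ρ σ : Matrix (α × β) (α × β) ℂ) :
    I.onBob m (ρ - c • σ) = I.onBob m ρ - c • I.onBob m σ := by
  simp [Instrument.onBob, Matrix.mul_sub, Matrix.sub_mul, Finset.smul_sum]

theorem LOCC.prob_sub_smul : {α β : Type} → [Fintype α] → [DecidableEq α] → [Fintype β] →
    [DecidableEq β] → (P : LOCC α β) → (c : ℝ) → (ρ σ : Matrix (α × β) (α × β) ℂ) →
    P.prob (ρ - c • σ) = P.prob ρ - c * P.prob σ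
  | _, _, _, _, _, _, @LOCC.output _ _ _ _ _ _ E _ _, c, ρ, σ => by
    simp [LOCC.prob, Matrix.mul_sub]
  | _, _, _, _, _, _, @LOCC.alice _ _ _ _ _ _ _ _ _ _ _ I next, c, ρ, σ => by
    simp only [LOCC.prob, I.onAlice_sub_smul, Finset.mul_sum, ← Finset.sum_sub_distrib]
    exact Finset.sum_congr rfl fun m _ => LOCC.prob_sub_smul (next m) c _ _
  | _, _, _, _, _, _, @LOCC.bob _ _ _ _ _ _ _ _ _ _ _ I next, c, ρ, σ => by
    simp only [LOCC.prob, I.onBob_sub_smul, Finset.mul_sum, ← Finset.sum_sub_distrib]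
    exact Finset.sum_congr rfl fun m _ => LOCC.prob_sub_smul (next m) c _ _

/-- Induction on the protocol tree. Positivity on product effects passes to each branch, and the
branch traces add up to the trace at the node. Full positivity of `D` is never needed. -/
theorem LOCC.prob_mem_Icc : {α β : Type} → [Fintype α] → [DecidableEq α] → [Fintype β] →
    [DecidableEq β] → (P : LOCC α β) → (D : Matrix (α × β) (α × β) ℂ) → BlockPos D →
    P.prob D ∈ Set.Icc 0 D.trace.re
  | _, _, _, _, _, _, @LOCC.output _ _ _ _ _ _ E h0 h1, D, hD => by
    refine ⟨hD 1 E PosSemidef.one h0, ?_⟩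
    -- The upper bound is positivity on the rejecting effect `1 ⊗ (1 - E)`, also a product.
    have h := hD 1 (1 - E) PosSemidef.one h1
    have hk : ∀ {α β : Type} [DecidableEq α] [DecidableEq β] (E : Matrix β β ℂ),
        (1 : Matrix α α ℂ) ⊗ₖ (1 - E) = 1 - (1 : Matrix α α ℂ) ⊗ₖ E := by
      intro α β _ _ E
      rw [eq_sub_iff_add_eq, ← kronecker_add, sub_add_cancel, one_kronecker_one]
    rw [hk, Matrix.sub_mul, trace_sub, Matrix.one_mul, Complex.sub_re] at h
    simp only [LOCC.prob]
    linarith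
  | _, _, _, _, _, _, @LOCC.alice _ _ _ _ _ _ _ _ _ _ _ I next, D, hD => by
    rw [← sum_trace_onAlice I D, Complex.re_sum]
    simp only [LOCC.prob]
    exact ⟨Finset.sum_nonneg fun m _ => (LOCC.prob_mem_Icc (next m) _ (hD.onAlice I m)).1,
      Finset.sum_le_sum fun m _ => (LOCC.prob_mem_Icc (next m) _ (hD.onAlice I m)).2⟩
  | _, _, _, _, _, _, @LOCC.bob _ _ _ _ _ _ _ _ _ _ _ I next, D, hD => by
    rw [← sum_trace_onBob I D, Complex.re_sum]
    simp only [LOCC.prob]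
    exact ⟨Finset.sum_nonneg fun m _ => (LOCC.prob_mem_Icc (next m) _ (hD.onBob I m)).1,
      Finset.sum_le_sum fun m _ => (LOCC.prob_mem_Icc (next m) _ (hD.onBob I m)).2⟩

/-- If `ρ` dominates `(1 - ε) σ` on product effects, then no protocol tells them apart with
advantage more than `ε`. -/
theorem LOCCIndistinguishable.of_blockPos {ε : ℝ} (hε : 0 ≤ ε)
    {ρ σ : Matrix (α × β) (α × β) ℂ} (hρ : ρ.trace = 1) (hσ : σ.trace = 1) (hσ' : BlockPos σ)
    (h : BlockPos (ρ - (1 - ε) • σ)) : LOCCIndistinguishable ε ρ σ := by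
  intro P
  obtain ⟨h1, h2⟩ := P.prob_mem_Icc _ h
  obtain ⟨h3, h4⟩ := P.prob_mem_Icc _ hσ'
  rw [LOCC.prob_sub_smul] at h1 h2
  simp only [trace_sub, trace_smul, hρ, hσ, Complex.sub_re, Complex.smul_re, Complex.one_re,
    smul_eq_mul] at h2 h4
  -- `P(ρ) - P(σ)` is the difference of `P(ρ) - (1 - ε) P(σ)` and `ε P(σ)`, both of which lie in
  -- `[0, ε]`.
  rw [abs_le]
  constructor <;> nlinarith

end Protocols

end LOCCHaar

end
noncomputable section

namespace LOCCHaar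

/-! ### Bombieri's inequality for the Fock norm -/

section Bombieri

open Finset ComplexConjugate
open scoped Nat

/-- The factorial of a multi-index. -/
def multiFactorial {σ : Type} [Fintype σ] (α : σ → ℕ) : ℕ := ∏ i, (α i)!

/-- Vandermonde's identity, written as a sum over two by two contingency tables. -/
theorem factorial_contingency (N a b a' b' : ℕ) (ha : a ≤ N) (hb : b ≤ N) :
    (if a + b = a' + b' then ((a + b)! : ℂ) else 0) =
      ∑ u ∈ range (N + 1), ∑ r ∈ range (N + 1), ∑ v ∈ range (N + 1), ∑ w ∈ range (N + 1),
        if u + v = a ∧ w + r = b ∧ u + w = a' ∧ v + r = b' then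
          ((a)! * (b)! * (a')! * (b')! / ((u)! * (r)! * (v)! * (w)!) : ℂ) else 0 := by
  have inner : ∀ u, (∑ r ∈ range (N + 1), ∑ v ∈ range (N + 1), ∑ w ∈ range (N + 1),
        if u + v = a ∧ w + r = b ∧ u + w = a' ∧ v + r = b' then
          ((a)! * (b)! * (a')! * (b')! / ((u)! * (r)! * (v)! * (w)!) : ℂ) else 0) =
      if a + b = a' + b' ∧ u ≤ a' then
        ((a')! * (b')! * (a.choose u * b.choose (a' - u)) : ℂ) else 0 := by
    intro u
    by_cases h : (a + b = a' + b' ∧ u ≤ a') ∧ u ≤ a ∧ a' - u ≤ b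
    -- A two by two table with given margins is determined by its corner `u`, so one term survives.
    · rw [sum_eq_single (b - (a' - u)), sum_eq_single (a - u), sum_eq_single (a' - u),
        if_pos (by omega), if_pos h.1]
      · rw [Nat.cast_choose ℂ h.2.1, Nat.cast_choose ℂ h.2.2]
        have h1 := Nat.factorial_ne_zero u
        have h2 := Nat.factorial_ne_zero (a - u)
        have h3 := Nat.factorial_ne_zero (a' - u)
        have h4 := Nat.factorial_ne_zero (b - (a' - u))
        field_simp
      all_goals first
        | (intro x _ hx; first
            | exact if_neg (by omega)
            | exact sum_eq_zero fun y _ => if_neg (by omega)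
            | exact sum_eq_zero fun y _ => sum_eq_zero fun z _ => if_neg (by omega))
        | (intro hx; exact absurd (mem_range.2 (by omega)) hx)
    · rw [sum_eq_zero fun x _ => sum_eq_zero fun y _ => sum_eq_zero fun z _ =>
        if_neg (by omega)]
      split_ifs with h'
      · have : a < u ∨ b < a' - u := by omega
        rcases this with h | h <;> simp [Nat.choose_eq_zero_of_lt h]
      · rfl
  simp_rw [inner]
  split_ifs with h
  · have hch : ((a + b)! : ℂ) = (a')! * (b')! * ((a + b).choose a' : ℕ) := by
      rw [h, Nat.cast_add_choose]
      have h1 := Nat.factorial_ne_zero a'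
      have h2 := Nat.factorial_ne_zero b'
      field_simp
    rw [hch, Nat.add_choose_eq, Nat.sum_antidiagonal_eq_sum_range_succ_mk]
    push_cast
    rw [mul_sum]
    -- Vandermonde sums `u` up to `a'`, the claim up to `N`, and neither bound need dominate. Both
    -- sums extend to a common range: the added terms vanish by the condition `u ≤ a'`, respectively
    -- because `a.choose u = 0` for `u > N ≥ a`.
    have e1 := sum_subset (s₁ := range (a' + 1)) (s₂ := range (N + a' + 1))
      (f := fun u => if a + b = a' + b' ∧ u ≤ a' then
        ((a')! * (b')! * (a.choose u * b.choose (a' - u)) : ℂ) else 0)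
      (range_subset_range.2 (by omega))
      (fun x _ hx => if_neg (by simp at hx; omega))
    have e2 := sum_subset (s₁ := range (N + 1)) (s₂ := range (N + a' + 1))
      (f := fun u => if a + b = a' + b' ∧ u ≤ a' then
        ((a')! * (b')! * (a.choose u * b.choose (a' - u)) : ℂ) else 0)
      (range_subset_range.2 (by omega))
      (fun x _ hx => by
        simp at hx
        simp [Nat.choose_eq_zero_of_lt (show a < x by omega)])
    rw [e2, ← e1]
    refine sum_congr rfl fun u hu => ?_
    rw [if_pos ⟨h, by simp at hu; omega⟩]
  · simp [h]

/-- The multi-index form of `factorial_contingency`. -/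
theorem multiFactorial_contingency {σ : Type} [Fintype σ] [DecidableEq σ] (N : ℕ)
    (α β α' β' : σ → ℕ) (ha : ∀ i, α i ≤ N) (hb : ∀ i, β i ≤ N) :
    (if α + β = α' + β' then (multiFactorial (α + β) : ℂ) else 0) =
      ∑ u ∈ Fintype.piFinset fun _ => range (N + 1), ∑ r ∈ Fintype.piFinset fun _ => range (N + 1),
      ∑ v ∈ Fintype.piFinset fun _ => range (N + 1), ∑ w ∈ Fintype.piFinset fun _ => range (N + 1),
        if u + v = α ∧ w + r = β ∧ u + w = α' ∧ v + r = β' then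
          (multiFactorial α * multiFactorial β * multiFactorial α' * multiFactorial β' /
            (multiFactorial u * multiFactorial r * multiFactorial v * multiFactorial w) : ℂ)
        else 0 := by
  have hl : (if α + β = α' + β' then (multiFactorial (α + β) : ℂ) else 0) =
      ∏ i, if α i + β i = α' i + β' i then ((α i + β i)! : ℂ) else 0 := by
    rw [prod_ite_zero]
    simp [funext_iff, multiFactorial]
  rw [hl]
  simp_rw [fun i => factorial_contingency N (α i) (β i) (α' i) (β' i) (ha i) (hb i),
    prod_univ_sum]
  refine sum_congr rfl fun u _ => sum_congr rfl fun r _ => sum_congr rfl fun v _ =>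
    sum_congr rfl fun w _ => ?_
  rw [prod_ite_zero]
  simp only [mem_univ, true_imp_iff, forall_and, funext_iff, Pi.add_apply, multiFactorial,
    Nat.cast_prod, prod_div_distrib, prod_mul_distrib]

/-- The Fock norm form of a product of homogeneous polynomials, `p` and `q` being the
coefficient functions. -/
theorem sum_mul_factorial_eq {σ : Type} [Fintype σ] [DecidableEq σ] (N : ℕ)
    (p q : (σ → ℕ) → ℂ) (hp : ∀ α, p α ≠ 0 → ∀ i, α i ≤ N) (hq : ∀ α, q α ≠ 0 → ∀ i, α i ≤ N) :
    (∑ α ∈ Fintype.piFinset fun _ => range (N + 1), ∑ β ∈ Fintype.piFinset fun _ => range (N + 1),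
      ∑ α' ∈ Fintype.piFinset fun _ => range (N + 1),
      ∑ β' ∈ Fintype.piFinset fun _ => range (N + 1),
        p α * q β * conj (p α') * conj (q β') *
          (if α + β = α' + β' then (multiFactorial (α + β) : ℂ) else 0)) =
    ∑ u ∈ Fintype.piFinset fun _ => range (N + 1), ∑ r ∈ Fintype.piFinset fun _ => range (N + 1),
      ((multiFactorial u * multiFactorial r : ℕ) : ℂ)⁻¹ *
        ((‖∑ v ∈ Fintype.piFinset fun _ => range (N + 1),
          multiFactorial (u + v) * p (u + v) * conj (multiFactorial (v + r) * q (v + r)) /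
            multiFactorial v‖ ^ 2 : ℝ) : ℂ) := by
  set S : Finset (σ → ℕ) := Fintype.piFinset fun _ => range (N + 1) with hS
  have memS : ∀ α : σ → ℕ, α ∈ S ↔ ∀ i, α i ≤ N := by
    simp [hS]
  -- For fixed `u` and `r` the summand separates: `p (u + v)` pairs with `conj (q (v + r))`, and `q
  -- (w + r)` with `conj (p (u + w))`. The second factor is the conjugate of the first with `w` in
  -- place of `v`, so the sum over `v` and `w` is a squared modulus.
  have key : ∀ α ∈ S, ∀ β ∈ S, ∀ α' ∈ S, ∀ β' ∈ S,
      p α * q β * conj (p α') * conj (q β') *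
          (if α + β = α' + β' then (multiFactorial (α + β) : ℂ) else 0) =
      ∑ u ∈ S, ∑ r ∈ S, ∑ v ∈ S, ∑ w ∈ S,
        if u + v = α then if w + r = β then if u + w = α' then if v + r = β' then
          (multiFactorial u * multiFactorial r : ℂ)⁻¹ *
          ((multiFactorial α * p α * conj (multiFactorial β' * q β') / multiFactorial v) *
          (multiFactorial β * q β * conj (multiFactorial α' * p α') / multiFactorial w))
          else 0 else 0 else 0 else 0 := by
    intro α hα β hβ α' hα' β' hβ'
    rw [multiFactorial_contingency N α β α' β' ((memS α).1 hα) ((memS β).1 hβ)]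
    simp_rw [mul_sum, ← ite_and]
    refine sum_congr rfl fun u _ => sum_congr rfl fun r _ => sum_congr rfl fun v _ =>
      sum_congr rfl fun w _ => ?_
    split_ifs
    · simp only [map_mul, Complex.conj_natCast, div_eq_mul_inv, mul_inv]
      ring
    · simp
  have swap (F : (σ → ℕ) → (σ → ℕ) → (σ → ℕ) → (σ → ℕ) →
      (σ → ℕ) → (σ → ℕ) → (σ → ℕ) → (σ → ℕ) → ℂ) :
      ∑ α ∈ S, ∑ β ∈ S, ∑ α' ∈ S, ∑ β' ∈ S, ∑ u ∈ S, ∑ r ∈ S, ∑ v ∈ S, ∑ w ∈ S,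
        F α β α' β' u r v w =
      ∑ u ∈ S, ∑ r ∈ S, ∑ v ∈ S, ∑ w ∈ S, ∑ α ∈ S, ∑ β ∈ S, ∑ α' ∈ S, ∑ β' ∈ S,
        F α β α' β' u r v w := by
    have := sum_comm (s := S ×ˢ S ×ˢ S ×ˢ S) (t := S ×ˢ S ×ˢ S ×ˢ S)
      (f := fun x y => F x.1 x.2.1 x.2.2.1 x.2.2.2 y.1 y.2.1 y.2.2.1 y.2.2.2)
    simpa only [sum_product] using this
  rw [sum_congr rfl fun α hα => sum_congr rfl fun β hβ => sum_congr rfl fun α' hα' =>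
    sum_congr rfl fun β' hβ' => key α hα β hβ α' hα' β' hβ', swap]
  refine sum_congr rfl fun u _ => sum_congr rfl fun r _ => ?_
  have hn (z : ℂ) : ((‖z‖ ^ 2 : ℝ) : ℂ) = z * conj z := by
    rw [Complex.mul_conj, Complex.normSq_eq_norm_sq]
  rw [hn, map_sum, sum_mul_sum, mul_sum]
  refine sum_congr rfl fun v _ => ?_
  rw [mul_sum]
  refine sum_congr rfl fun w _ => ?_
  -- The indices `u + v` and the like may leave the box `S`, but there the coefficients vanish.
  have hp' : u + v ∉ S → p (u + v) = 0 := fun h => by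
    by_contra h'
    exact h ((memS _).2 (hp _ h'))
  have hp'' : u + w ∉ S → p (u + w) = 0 := fun h => by
    by_contra h'
    exact h ((memS _).2 (hp _ h'))
  have hq' : w + r ∉ S → q (w + r) = 0 := fun h => by
    by_contra h'
    exact h ((memS _).2 (hq _ h'))
  have hq'' : v + r ∉ S → q (v + r) = 0 := fun h => by
    by_contra h'
    exact h ((memS _).2 (hq _ h'))
  rw [sum_eq_single (u + v), sum_eq_single (w + r), sum_eq_single (u + w),
    sum_eq_single (v + r)]
  · simp only [if_true, Nat.cast_mul, map_mul, map_div₀, Complex.conj_natCast, Complex.conj_conj]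
    ring
  · intro x _ hx
    simp [Ne.symm hx]
  · intro h
    simp [hq'' h]
  · intro x _ hx
    simp [Ne.symm hx]
  · intro h
    simp [hp'' h]
  · intro x _ hx
    simp [Ne.symm hx]
  · intro h
    simp [hq' h]
  · intro x _ hx
    simp [Ne.symm hx]
  · intro h
    simp [hp' h]

/-- Bombieri's inequality for the Fock norm: the norm of a product of homogeneous polynomials
is at least the product of their norms. -/
theorem bombieri {σ : Type} [Fintype σ] [DecidableEq σ] (t : ℕ)
    (p q : (σ → ℕ) → ℂ) (hp : ∀ α, p α ≠ 0 → ∑ i, α i = t) (hq : ∀ α, q α ≠ 0 → ∑ i, α i = t) :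
    (∑ α ∈ Fintype.piFinset fun _ => range (t + 1), multiFactorial α * ‖p α‖ ^ 2) *
      (∑ α ∈ Fintype.piFinset fun _ => range (t + 1), multiFactorial α * ‖q α‖ ^ 2) ≤
    (∑ α ∈ Fintype.piFinset fun _ => range (t + 1), ∑ β ∈ Fintype.piFinset fun _ => range (t + 1),
      ∑ α' ∈ Fintype.piFinset fun _ => range (t + 1),
      ∑ β' ∈ Fintype.piFinset fun _ => range (t + 1),
        p α * q β * conj (p α') * conj (q β') *
          (if α + β = α' + β' then (multiFactorial (α + β) : ℂ) else 0)).re := by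
  have hle : ∀ α : σ → ℕ, ∑ i, α i = t → ∀ i, α i ≤ t := fun α h i =>
    h ▸ single_le_sum (f := α) (fun _ _ => Nat.zero_le _) (mem_univ i)
  rw [sum_mul_factorial_eq t p q (fun α h => hle α (hp α h)) (fun α h => hle α (hq α h)),
    sum_mul_sum, Complex.re_sum]
  refine sum_le_sum fun u _ => ?_
  rw [Complex.re_sum]
  refine sum_le_sum fun r _ => ?_
  have hre (m : ℕ) (x : ℝ) : ((m : ℂ)⁻¹ * (x : ℂ)).re = (m : ℝ)⁻¹ * x := by
    rw [← Complex.ofReal_natCast, ← Complex.ofReal_inv, ← Complex.ofReal_mul, Complex.ofReal_re]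
  rw [hre]
  -- The inequality is termwise in `(u, r)`. If `p u` or `q r` vanishes, the left term is zero and
  -- the right one nonnegative; otherwise the two terms are equal.
  by_cases hu : p u = 0
  · simp only [hu, norm_zero]
    exact le_trans (by simp) (by positivity : (0 : ℝ) ≤ _)
  by_cases hr : q r = 0
  · simp only [hr, norm_zero]
    exact le_trans (by simp) (by positivity : (0 : ℝ) ≤ _)
  -- By homogeneity `p u` and `p (u + v)` can both be nonzero only for `v = 0`.
  rw [sum_eq_single 0]
  · have h0 : multiFactorial (0 : σ → ℕ) = 1 := by simp [multiFactorial]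
    have hu0 : (multiFactorial u : ℝ) ≠ 0 := by
      simp [multiFactorial, prod_ne_zero_iff, Nat.factorial_ne_zero]
    have hr0 : (multiFactorial r : ℝ) ≠ 0 := by
      simp [multiFactorial, prod_ne_zero_iff, Nat.factorial_ne_zero]
    simp only [add_zero, zero_add, h0, Nat.cast_one, div_one, norm_mul, Complex.norm_natCast,
      RCLike.norm_conj, Nat.cast_mul]
    apply le_of_eq
    field_simp
  · intro v _ hv
    have : p (u + v) = 0 := by
      by_contra h
      have h1 := hp _ h
      have h2 := hp _ hu
      simp only [Pi.add_apply, sum_add_distrib, h2] at h1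
      apply hv
      funext i
      have h3 : ∑ i, v i = 0 := by omega
      exact (sum_eq_zero_iff.1 h3) i (mem_univ i)
    simp [this]
  · intro h
    simp at h

end Bombieri
end LOCCHaar
end
noncomputable section

namespace LOCCHaar

/-! ### Gaussian moments and moments of the Haar distribution -/

section Moments

open MeasureTheory Set ComplexConjugate
open scoped Nat Real

/-- The Gaussian weight and Lebesgue measure are invariant under `z ↦ ω z`. A phase other than `1`
in front therefore forces the moment to vanish. -/
theorem integral_complex_gaussian_rotate (a b : ℕ) (ω : ℂ) (hω : ‖ω‖ = 1) :
    ∫ z : ℂ, z ^ a * conj z ^ b * Real.exp (-‖z‖ ^ 2) =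
      ω ^ a * conj ω ^ b * ∫ z : ℂ, z ^ a * conj z ^ b * Real.exp (-‖z‖ ^ 2) := by
  let c : Circle := ⟨ω, mem_sphere_zero_iff_norm.2 hω⟩
  have h := (rotation c).measurePreserving.integral_comp
    (rotation c).toHomeomorph.measurableEmbedding
    (fun z : ℂ => z ^ a * conj z ^ b * (Real.exp (-‖z‖ ^ 2) : ℂ))
  refine h.symm.trans ?_
  rw [← integral_const_mul]
  refine integral_congr_ae (.of_forall fun z => ?_)
  have hc : rotation c z = ω * z := rotation_apply c z
  simp only [hc, map_mul, norm_mul, hω, mul_pow, one_mul]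
  ring

/-- Moments of the complex Gaussian measure on the plane. -/
theorem integral_complex_gaussian (a b : ℕ) :
    ∫ z : ℂ, z ^ a * conj z ^ b * Real.exp (-‖z‖ ^ 2) = if a = b then (π * a ! : ℂ) else 0 := by
  split_ifs with h
  · subst h
    have h1 := Complex.integral_rpow_mul_exp_neg_rpow (p := 2) (q := 2 * a) (by norm_num)
      (by have : (0 : ℝ) ≤ a := by positivity
          linarith)
    have h2 : (2 * (a : ℝ) + 2) / 2 = a + 1 := by ring
    rw [h2, Real.Gamma_nat_eq_factorial] at h1
    have h3 : ∀ z : ℂ, z ^ a * conj z ^ a * (Real.exp (-‖z‖ ^ 2) : ℂ) =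
        ((‖z‖ ^ (2 * (a : ℝ)) * Real.exp (-‖z‖ ^ (2 : ℝ)) : ℝ) : ℂ) := by
      intro z
      rw [← mul_pow, Complex.mul_conj, Complex.normSq_eq_norm_sq, Real.rpow_mul (norm_nonneg z),
        Real.rpow_two, Real.rpow_natCast]
      push_cast
      rfl
    simp_rw [h3]
    rw [integral_complex_ofReal, h1]
    push_cast
    ring
  -- The angle of one radian serves all `a ≠ b` at once: `ω ^ (a - b) = 1` would make `a - b` a
  -- multiple of `2π`, contradicting the irrationality of `π`.
  · set ω : ℂ := Complex.exp (Complex.I) with hω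
    have hn : ‖ω‖ = 1 := by simpa using Complex.norm_exp_ofReal_mul_I 1
    have hr := integral_complex_gaussian_rotate a b ω hn
    by_contra hne
    have h1 : ω ^ a * conj ω ^ b = 1 := by
      have := mul_right_cancel₀ hne ((one_mul _).trans hr)
      exact this.symm
    have h2 : ω ^ a * conj ω ^ b = Complex.exp (((a : ℂ) - b) * Complex.I) := by
      rw [hω, ← Complex.exp_conj, ← Complex.exp_nat_mul, ← Complex.exp_nat_mul,
        ← Complex.exp_add, Complex.conj_I]
      congr 1
      ring
    rw [h2, Complex.exp_eq_one_iff] at h1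
    obtain ⟨k, hk⟩ := h1
    have h4 : ((a : ℝ) - b) = k * (2 * π) := by
      have h5 : ((a : ℂ) - b) * Complex.I = (k * (2 * π)) * Complex.I := by rw [hk]; ring
      have h6 := mul_right_cancel₀ Complex.I_ne_zero h5
      exact_mod_cast h6
    have hk0 : (k : ℝ) ≠ 0 := by
      intro h0
      rw [h0, zero_mul, sub_eq_zero] at h4
      exact h (by exact_mod_cast h4)
    apply irrational_pi
    refine ⟨((a : ℚ) - b) / (2 * k), ?_⟩
    push_cast
    rw [h4]
    field_simp

/-- Gaussian integral of a homogeneous function in polar coordinates. -/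
theorem integral_homogeneous_mul_gaussian {E : Type} [NormedAddCommGroup E] [NormedSpace ℝ E]
    [FiniteDimensional ℝ E] [Nontrivial E] [MeasurableSpace E] [BorelSpace E] (μ : Measure E)
    [μ.IsAddHaarMeasure] (f : E → ℂ) (k : ℕ)
    (hf : ∀ (r : ℝ) (x : E), 0 < r → f (r • x) = (r : ℂ) ^ k * f x) :
    ∫ x, f x * Real.exp (-‖x‖ ^ 2) ∂μ =
      (∫ x : Metric.sphere (0 : E) 1, f x ∂μ.toSphere) *
        (Real.Gamma ((Module.finrank ℝ E + k : ℝ) / 2) / 2 : ℝ) := by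
  have hdim : 0 < Module.finrank ℝ E := Module.finrank_pos
  set D := Module.finrank ℝ E with hD
  -- The radial measure has density `r ^ (D - 1)`, a true predecessor since `D > 0`. The radial
  -- factor is thus the Gamma integral of `r ^ (D - 1 + k) * exp (-r ^ 2)`.
  have hrad : ∫ r : Ioi (0 : ℝ), ((r : ℝ) : ℂ) ^ k * Real.exp (-(r : ℝ) ^ 2)
      ∂(Measure.volumeIoiPow (D - 1)) = (Real.Gamma ((D + k : ℝ) / 2) / 2 : ℝ) := by
    have hG := integral_rpow_mul_exp_neg_rpow (p := 2) (q := (D - 1 : ℕ) + k) (by norm_num)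
      (by have : (0 : ℝ) ≤ ((D - 1 : ℕ) : ℝ) + k := by positivity
          linarith)
    have h2 : (((D - 1 : ℕ) : ℝ) + k + 1) / 2 = (D + k) / 2 := by
      rw [Nat.cast_pred hdim]; ring
    rw [h2] at hG
    simp only [Measure.volumeIoiPow, ENNReal.ofReal]
    rw [integral_withDensity_eq_integral_smul, integral_subtype_comap measurableSet_Ioi
      fun a : ℝ ↦ Real.toNNReal (a ^ (D - 1)) • ((a : ℂ) ^ k * (Real.exp (-a ^ 2) : ℂ)),
      setIntegral_congr_fun (g := fun a : ℝ => ((a ^ (((D - 1 : ℕ) : ℝ) + k) *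
        Real.exp (-a ^ (2 : ℝ)) : ℝ) : ℂ)) measurableSet_Ioi fun x hx ↦ ?_]
    · rw [integral_complex_ofReal, hG]
      congr 1
      ring
    · have hx' : (0 : ℝ) < x := hx
      beta_reduce
      rw [NNReal.smul_def, Real.coe_toNNReal _ (pow_nonneg hx'.le _), ← Nat.cast_add,
        Real.rpow_natCast, Real.rpow_two, pow_add, Complex.real_smul]
      push_cast
      ring
    · exact (measurable_subtype_coe.pow_const _).real_toNNReal
  calc ∫ x, f x * Real.exp (-‖x‖ ^ 2) ∂μ
      = ∫ x : ({(0)}ᶜ : Set E), f x.1 * Real.exp (-‖x.1‖ ^ 2) ∂(μ.comap (↑)) := by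
        rw [integral_subtype_comap (measurableSet_singleton _).compl
          fun x ↦ f x * (Real.exp (-‖x‖ ^ 2) : ℂ), restrict_compl_singleton]
    _ = ∫ y : Metric.sphere (0 : E) 1 × Ioi (0 : ℝ),
          f y.1 * (((y.2 : ℝ) : ℂ) ^ k * Real.exp (-(y.2 : ℝ) ^ 2))
          ∂μ.toSphere.prod (.volumeIoiPow (D - 1)) := by
        rw [← μ.measurePreserving_homeomorphUnitSphereProd.integral_comp
          (Homeomorph.measurableEmbedding _)]
        congr 1
        ext x
        have hx : x.1 ≠ 0 := x.2
        have hpos : 0 < ‖x.1‖ := norm_pos_iff.2 hx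
        have h1 : f x.1 = (‖x.1‖ : ℂ) ^ k * f (‖x.1‖⁻¹ • x.1) := by
          rw [← hf _ _ hpos, smul_smul, mul_inv_cancel₀ hpos.ne', one_smul]
        simp only [homeomorphUnitSphereProd_apply_snd_coe, homeomorphUnitSphereProd_apply_fst_coe]
        rw [h1]
        ring
    _ = _ := by
        rw [integral_prod_mul (fun y : Metric.sphere (0 : E) 1 => f y)
          (fun r : Ioi (0 : ℝ) => ((r : ℝ) : ℂ) ^ k * (Real.exp (-(r : ℝ) ^ 2) : ℂ)), hrad]

/-- Gaussian moments on a complex Euclidean space, up to the normalization of its volume. -/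
theorem exists_integral_monomial_gaussian (ι : Type) [Fintype ι] :
    ∃ c : ℂ, c ≠ 0 ∧ ∀ α β : ι → ℕ,
      ∫ x : EuclideanSpace ℂ ι, (∏ i, x i ^ α i) * conj (∏ i, x i ^ β i) * Real.exp (-‖x‖ ^ 2) =
        if α = β then c * ∏ i, ((α i)! : ℂ) else 0 := by
  let e := (PiLp.continuousLinearEquiv 2 ℝ (fun _ : ι => ℂ)).symm
  let ν : Measure (EuclideanSpace ℂ ι) := (volume : Measure (ι → ℂ)).map e
  have : ν.IsAddHaarMeasure := e.isAddHaarMeasure_map volume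
  -- Uniqueness of Haar measure up to scale suffices: the factor `κ` goes into `c`, which later
  -- cancels.
  have hν := Measure.isAddLeftInvariant_eq_smul (volume : Measure (EuclideanSpace ℂ ι)) ν
  set κ := Measure.addHaarScalarFactor (volume : Measure (EuclideanSpace ℂ ι)) ν with hκ
  have hκ0 : κ ≠ 0 := (Measure.addHaarScalarFactor_pos_of_isAddHaarMeasure _ _).ne'
  refine ⟨(κ : ℝ) * ∏ _i : ι, (π : ℂ), ?_, fun α β => ?_⟩
  · refine mul_ne_zero (by exact_mod_cast hκ0) (Finset.prod_ne_zero_iff.2 fun _ _ => ?_)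
    exact_mod_cast Real.pi_ne_zero
  have he : MeasurableEmbedding e := e.toHomeomorph.measurableEmbedding
  rw [hν, integral_smul_nnreal_measure]
  have hint : ∀ x : ι → ℂ, (∏ i, (e x) i ^ α i) * conj (∏ i, (e x) i ^ β i) *
      (Real.exp (-‖e x‖ ^ 2) : ℂ) = ∏ i, (x i ^ α i * conj (x i) ^ β i *
        (Real.exp (-‖x i‖ ^ 2) : ℂ)) := by
    intro x
    rw [EuclideanSpace.norm_sq_eq, ← Finset.sum_neg_distrib, Real.exp_sum, Finset.prod_mul_distrib,
      Finset.prod_mul_distrib, map_prod, Complex.ofReal_prod]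
    simp only [map_pow]
    rfl
  have hfin : ∫ x : ι → ℂ, (∏ i, (e x) i ^ α i) * conj (∏ i, (e x) i ^ β i) *
      (Real.exp (-‖e x‖ ^ 2) : ℂ) = if α = β then (∏ _i : ι, (π : ℂ)) * ∏ i, ((α i)! : ℂ)
        else 0 := by
    simp_rw [hint]
    rw [integral_fintype_prod_volume_eq_prod (fun i (z : ℂ) => z ^ α i * conj z ^ β i *
        (Real.exp (-‖z‖ ^ 2) : ℂ))]
    simp_rw [integral_complex_gaussian]
    rw [Finset.prod_ite_zero]
    simp [funext_iff, Finset.prod_mul_distrib]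
  refine (congrArg (κ • ·) ((he.integral_map _).trans hfin)).trans ?_
  split_ifs
  · rw [NNReal.smul_def, Complex.real_smul, mul_assoc]
  · simp

/-- Moments of the Haar distribution. -/
theorem integral_haarState_monomial (n m : ℕ) (α β : Bits n → ℕ) (hα : ∑ i, α i = m)
    (hβ : ∑ i, β i = m) :
    ∫ ψ : PureState n, (∏ i, ψ.1 i ^ α i) * conj (∏ i, ψ.1 i ^ β i) ∂haarState n =
      if α = β then (∏ i, ((α i)! : ℂ)) * ((2 ^ n - 1)! / (2 ^ n + m - 1)! : ℝ) else 0 := by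
  obtain ⟨c, hc, hmom⟩ := exists_integral_monomial_gaussian (Bits n)
  have hfin : Module.finrank ℝ (EuclideanSpace ℂ (Bits n)) = 2 * 2 ^ n := by
    rw [← Module.finrank_mul_finrank ℝ ℂ, Complex.finrank_real_complex, finrank_euclideanSpace]
    simp
  have hpow : 1 ≤ 2 ^ n := Nat.one_le_two_pow
  have hGamma (k : ℕ) : Real.Gamma (((Module.finrank ℝ (EuclideanSpace ℂ (Bits n)) : ℕ) +
      (2 * k : ℕ) : ℝ) / 2) = (2 ^ n + k - 1)! := by
    rw [hfin, ← Real.Gamma_nat_eq_factorial]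
    congr 1
    have : ((2 ^ n + k - 1 : ℕ) : ℝ) = 2 ^ n + k - 1 := by
      rw [Nat.cast_sub (by omega)]
      push_cast
      ring
    rw [this]
    push_cast
    ring
  have hα' := integral_homogeneous_mul_gaussian (volume : Measure (EuclideanSpace ℂ (Bits n)))
    (fun x => (∏ i, x i ^ α i) * conj (∏ i, x i ^ β i)) (2 * m) (by
      intro r x _
      simp only [PiLp.smul_apply, Complex.real_smul, mul_pow, Finset.prod_mul_distrib, map_mul,
        Finset.prod_pow_eq_pow_sum, hα, hβ, map_pow, Complex.conj_ofReal]
      ring)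
  -- The degree zero case expresses the total mass of the sphere through `c`. Dividing by it
  -- normalizes the measure and removes `c`.
  have h0' := integral_homogeneous_mul_gaussian (volume : Measure (EuclideanSpace ℂ (Bits n)))
    (fun x => (∏ i, x i ^ (0 : Bits n → ℕ) i) * conj (∏ i, x i ^ (0 : Bits n → ℕ) i)) (2 * 0)
    (by simp)
  rw [hmom, hGamma] at hα' h0'
  simp only [if_true, Pi.zero_apply, pow_zero, Finset.prod_const_one, map_one, mul_one,
    Nat.factorial_zero, Nat.cast_one, integral_const, add_zero] at h0'
  set T : ℝ := (volume : Measure (EuclideanSpace ℂ (Bits n))).toSphere.real univ with hT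
  rw [haarState, integral_smul_measure, ENNReal.toReal_inv]
  change T⁻¹ • _ = _
  have hT0 : (T : ℂ) ≠ 0 := by
    intro h
    apply hc
    rw [h0', Complex.real_smul, h]
    simp
  have hf1 : ((2 ^ n + m - 1)! : ℂ) ≠ 0 := by exact_mod_cast Nat.factorial_ne_zero _
  have hf0 : ((2 ^ n - 1)! : ℂ) ≠ 0 := by exact_mod_cast Nat.factorial_ne_zero _
  set J := ∫ x : Metric.sphere (0 : EuclideanSpace ℂ (Bits n)) 1,
    (∏ i, x.1 i ^ α i) * conj (∏ i, x.1 i ^ β i)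
      ∂(volume : Measure (EuclideanSpace ℂ (Bits n))).toSphere with hJ
  rw [Complex.real_smul] at h0' ⊢
  have hJ' : J = (if α = β then c * ∏ i, ((α i)! : ℂ) else 0) * 2 / (2 ^ n + m - 1)! := by
    rw [hα']
    push_cast
    field_simp
  rw [hJ', h0']
  push_cast
  split_ifs
  · field_simp
  · simp

end Moments
end LOCCHaar
end
noncomputable section

namespace LOCCHaar

/-! ### Weights and second moments of homogeneous polynomials -/

section HaarInequality

open MeasureTheory Matrix Finset ComplexConjugate
open scoped Nat Kronecker ComplexOrder

/-- The value of `E |z^α|²` on the unit sphere of `ℂ^(2^n)`, up to the factor `α!`, for multi-indices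
`α` of degree `m`. -/
def haarWeight (n m : ℕ) : ℝ := (2 ^ n - 1)! / (2 ^ n + m - 1)!

theorem haarWeight_nonneg (n m : ℕ) : 0 ≤ haarWeight n m := by
  unfold haarWeight
  positivity

/-- Induction on `j` with `t` held fixed; the application has `j = t`. The factor `1 - j * t / d`
may be negative, which is harmless because it is only multiplied by nonnegative quantities. -/
theorem one_sub_mul_prod_le (d t : ℝ) (hd : 0 < d) (ht : 0 ≤ t) (j : ℕ) :
    (1 - j * t / d) * ∏ i ∈ range j, (d + t + i) ≤ ∏ i ∈ range j, (d + i) := by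
  induction j with
  | zero => simp
  | succ j ih =>
    rw [prod_range_succ, prod_range_succ]
    have hX : 0 ≤ ∏ i ∈ range j, (d + t + i) := prod_nonneg fun i _ => by positivity
    have h1 : (1 - ((j + 1 : ℕ) : ℝ) * t / d) * (d + t + j) ≤ (1 - j * t / d) * (d + j) := by
      have h2 : (1 - j * t / d) * (d + j) - (1 - ((j + 1 : ℕ) : ℝ) * t / d) * (d + t + j) =
          j * t / d * t + t ^ 2 / d + t * j / d := by
        push_cast
        field_simp
        ring
      have h3 : 0 ≤ j * t / d * t + t ^ 2 / d + t * j / d := by positivity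
      linarith
    calc (1 - ((j + 1 : ℕ) : ℝ) * t / d) * ((∏ i ∈ range j, (d + t + i)) * (d + t + j))
        = (∏ i ∈ range j, (d + t + i)) * ((1 - ((j + 1 : ℕ) : ℝ) * t / d) * (d + t + j)) := by
          ring
      _ ≤ (∏ i ∈ range j, (d + t + i)) * ((1 - j * t / d) * (d + j)) := by gcongr
      _ = ((1 - j * t / d) * ∏ i ∈ range j, (d + t + i)) * (d + j) := by ring
      _ ≤ _ := by gcongr

theorem factorial_add_sub_one (d k : ℕ) (hd : 1 ≤ d) :
    ((d + k - 1)! : ℝ) = (d - 1)! * ∏ i ∈ range k, ((d : ℝ) + i) := by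
  induction k with
  | zero => simp
  | succ k ih =>
    have h : d + (k + 1) - 1 = (d + k - 1) + 1 := by omega
    have h' : (d + k - 1) + 1 = d + k := by omega
    rw [h, Nat.factorial_succ, Nat.cast_mul, ih, prod_range_succ, h']
    push_cast
    ring

/-- After cancelling factorials, `w(2t) / w(t)²` is the quotient of the rising products from `d` and
from `d + t`, each of length `t`. This is the only source of the error `t² / 2 ^ n`. -/
theorem haarWeight_two_mul (n t : ℕ) :
    (1 - (t : ℝ) ^ 2 / 2 ^ n) * haarWeight n t ^ 2 ≤ haarWeight n (2 * t) := by
  have hd : 1 ≤ 2 ^ n := Nat.one_le_two_pow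
  have h1 := factorial_add_sub_one (2 ^ n) t hd
  have h2 := factorial_add_sub_one (2 ^ n + t) t (by omega)
  have h3 := one_sub_mul_prod_le (2 ^ n) t (by positivity) (by positivity) t
  have h4 : 2 ^ n + t + t - 1 = 2 ^ n + 2 * t - 1 := by omega
  rw [h4] at h2
  push_cast at h1 h2
  have hpos : (0 : ℝ) < (2 ^ n + t - 1)! := by exact_mod_cast Nat.factorial_pos _
  have hpos0 : (0 : ℝ) < (2 ^ n - 1)! := by exact_mod_cast Nat.factorial_pos _
  have hpos2 : (0 : ℝ) < (2 ^ n + 2 * t - 1)! := by exact_mod_cast Nat.factorial_pos _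
  unfold haarWeight
  rw [div_pow, ← mul_div_assoc, div_le_div_iff₀ (by positivity) hpos2, h2]
  have h5 : (1 - (t : ℝ) * t / 2 ^ n) * (∏ i ∈ range t, ((2 : ℝ) ^ n + t + i)) *
      (((2 ^ n - 1)! : ℝ) ^ 2 * (2 ^ n + t - 1)!) ≤
      (∏ i ∈ range t, ((2 : ℝ) ^ n + i)) * (((2 ^ n - 1)! : ℝ) ^ 2 * (2 ^ n + t - 1)!) := by
    gcongr
  calc _ = (1 - (t : ℝ) * t / 2 ^ n) * (∏ i ∈ range t, ((2 : ℝ) ^ n + t + i)) *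
      (((2 ^ n - 1)! : ℝ) ^ 2 * (2 ^ n + t - 1)!) := by ring
    _ ≤ _ := h5
    _ = _ := by
      rw [sq ((2 ^ n + t - 1)! : ℝ)]
      nth_rewrite 3 [h1]
      ring

theorem integrable_haarState {n : ℕ} {f : PureState n → ℂ} (hf : Continuous f) :
    Integrable f (haarState n) :=
  hf.integrable_of_hasCompactSupport (HasCompactSupport.of_compactSpace f)

/-- The homogeneous polynomial with coefficients `p`, as a function on pure states. -/
def polyVal (n t : ℕ) (p : (Bits n → ℕ) → ℂ) (ψ : PureState n) : ℂ :=
  ∑ α ∈ Fintype.piFinset fun _ => range (t + 1), p α * ∏ i, ψ.1 i ^ α i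

theorem continuous_polyVal (n t : ℕ) (p : (Bits n → ℕ) → ℂ) : Continuous (polyVal n t p) := by
  unfold polyVal
  fun_prop

/-- The Fock norm of a homogeneous polynomial. -/
def fockSq (n t : ℕ) (p : (Bits n → ℕ) → ℂ) : ℝ :=
  ∑ α ∈ Fintype.piFinset fun _ => range (t + 1), multiFactorial α * ‖p α‖ ^ 2

theorem fockSq_nonneg (n t : ℕ) (p : (Bits n → ℕ) → ℂ) : 0 ≤ fockSq n t p := by
  unfold fockSq
  positivity

theorem ofReal_norm_sq (z : ℂ) : ((‖z‖ ^ 2 : ℝ) : ℂ) = z * conj z := by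
  rw [Complex.mul_conj, Complex.normSq_eq_norm_sq]

/-- Distinct monomials are orthogonal under the Haar distribution, and all those of degree `t` carry
the same weight. -/
theorem integral_norm_polyVal_sq (n t : ℕ) (p : (Bits n → ℕ) → ℂ)
    (hp : ∀ α, p α ≠ 0 → ∑ i, α i = t) :
    ∫ ψ, ((‖polyVal n t p ψ‖ ^ 2 : ℝ) : ℂ) ∂haarState n =
      ((haarWeight n t * fockSq n t p : ℝ) : ℂ) := by
  have hexp : ∀ ψ : PureState n, ((‖polyVal n t p ψ‖ ^ 2 : ℝ) : ℂ) =
      ∑ α ∈ Fintype.piFinset fun _ => range (t + 1), ∑ β ∈ Fintype.piFinset fun _ => range (t + 1),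
        p α * conj (p β) * ((∏ i, ψ.1 i ^ α i) * conj (∏ i, ψ.1 i ^ β i)) := by
    intro ψ
    rw [ofReal_norm_sq, polyVal, map_sum, sum_mul_sum]
    refine sum_congr rfl fun α _ => sum_congr rfl fun β _ => ?_
    rw [map_mul]
    ring
  have hc : ∀ α β : Bits n → ℕ, Continuous fun ψ : PureState n =>
      p α * conj (p β) * ((∏ i, ψ.1 i ^ α i) * conj (∏ i, ψ.1 i ^ β i)) := by
    intro α β
    fun_prop
  simp_rw [hexp]
  rw [integral_finsetSum _ fun α _ => integrable_finsetSum _ fun β _ =>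
    integrable_haarState (hc α β)]
  simp_rw [fun α => integral_finsetSum (Fintype.piFinset fun _ : Bits n => range (t + 1))
    fun β _ => integrable_haarState (hc α β), integral_const_mul]
  rw [fockSq, mul_sum, Complex.ofReal_sum]
  refine sum_congr rfl fun α hα => ?_
  by_cases h : p α = 0
  · simp [h]
  rw [sum_eq_single α]
  · rw [integral_haarState_monomial n t α α (hp _ h) (hp _ h), if_pos rfl, haarWeight,
      multiFactorial]
    have := ofReal_norm_sq (p α)
    rw [← this]
    push_cast
    ring
  · intro β _ hβ
    by_cases h' : p β = 0
    · simp [h']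
    rw [integral_haarState_monomial n t α β (hp _ h) (hp _ h'), if_neg (Ne.symm hβ), mul_zero]
  · exact fun h => absurd hα h

/-- The integral equals `haarWeight n (2 * t)` times the squared Fock norm of the product `p q`,
homogeneous of degree `2 * t`, to which `bombieri` applies. -/
theorem fockSq_mul_fockSq_le (n t : ℕ) (p q : (Bits n → ℕ) → ℂ)
    (hp : ∀ α, p α ≠ 0 → ∑ i, α i = t) (hq : ∀ α, q α ≠ 0 → ∑ i, α i = t) :
    haarWeight n (2 * t) * (fockSq n t p * fockSq n t q) ≤
      (∫ ψ, ((‖polyVal n t p ψ‖ ^ 2 : ℝ) : ℂ) * ((‖polyVal n t q ψ‖ ^ 2 : ℝ) : ℂ)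
        ∂haarState n).re := by
  set S : Finset (Bits n → ℕ) := Fintype.piFinset fun _ => range (t + 1) with hS
  have hexp : ∀ ψ : PureState n,
      ((‖polyVal n t p ψ‖ ^ 2 : ℝ) : ℂ) * ((‖polyVal n t q ψ‖ ^ 2 : ℝ) : ℂ) =
      ∑ x ∈ S ×ˢ S ×ˢ S ×ˢ S, p x.1 * q x.2.1 * conj (p x.2.2.1) * conj (q x.2.2.2) *
        ((∏ i, ψ.1 i ^ (x.1 + x.2.1) i) * conj (∏ i, ψ.1 i ^ (x.2.2.1 + x.2.2.2) i)) := by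
    intro ψ
    rw [ofReal_norm_sq, ofReal_norm_sq, polyVal, polyVal, ← hS, mul_mul_mul_comm, map_sum, map_sum,
      sum_mul_sum, sum_mul_sum, sum_mul, sum_product]
    refine sum_congr rfl fun α _ => ?_
    rw [sum_mul, sum_product]
    refine sum_congr rfl fun β _ => ?_
    rw [mul_sum, sum_product]
    refine sum_congr rfl fun α' _ => ?_
    rw [mul_sum]
    refine sum_congr rfl fun β' _ => ?_
    simp only [Pi.add_apply, pow_add, prod_mul_distrib, map_mul]
    ring
  have hc : ∀ x : (Bits n → ℕ) × (Bits n → ℕ) × (Bits n → ℕ) × (Bits n → ℕ),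
      Continuous fun ψ : PureState n =>
      p x.1 * q x.2.1 * conj (p x.2.2.1) * conj (q x.2.2.2) *
        ((∏ i, ψ.1 i ^ (x.1 + x.2.1) i) * conj (∏ i, ψ.1 i ^ (x.2.2.1 + x.2.2.2) i)) := by
    intro x
    fun_prop
  have hint : ∫ ψ, ((‖polyVal n t p ψ‖ ^ 2 : ℝ) : ℂ) * ((‖polyVal n t q ψ‖ ^ 2 : ℝ) : ℂ)
        ∂haarState n = (haarWeight n (2 * t) : ℂ) *
      ∑ α ∈ S, ∑ β ∈ S, ∑ α' ∈ S, ∑ β' ∈ S, p α * q β * conj (p α') * conj (q β') *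
          (if α + β = α' + β' then (multiFactorial (α + β) : ℂ) else 0) := by
    simp_rw [hexp]
    rw [integral_finsetSum _ fun x _ => integrable_haarState (hc x)]
    simp_rw [integral_const_mul, sum_product, mul_sum]
    refine sum_congr rfl fun α _ => sum_congr rfl fun β _ => sum_congr rfl fun α' _ =>
      sum_congr rfl fun β' _ => ?_
    by_cases h1 : p α = 0
    · simp [h1]
    by_cases h2 : q β = 0
    · simp [h2]
    by_cases h3 : p α' = 0
    · simp [h3]
    by_cases h4 : q β' = 0
    · simp [h4]
    rw [integral_haarState_monomial n (2 * t) (α + β) (α' + β')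
      (by simp only [Pi.add_apply, sum_add_distrib, hp _ h1, hq _ h2]; ring)
      (by simp only [Pi.add_apply, sum_add_distrib, hp _ h3, hq _ h4]; ring)]
    split_ifs
    · simp only [haarWeight, multiFactorial, Nat.cast_prod]
      ring
    · simp
  rw [hint, Complex.re_ofReal_mul]
  exact mul_le_mul_of_nonneg_left (bombieri t p q hp hq) (haarWeight_nonneg _ _)

/-! ### From effects on `t` copies to homogeneous polynomials -/

/-- The number of occurrences of each letter in a word. -/
def occurrences {n t : ℕ} (x : Reg n t) (i : Bits n) : ℕ := #{j | x j = i}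

/-- Coefficients of the polynomial `z ↦ ∑ x, a x * ∏ j, z (x j)`. -/
def wordCoeff {n t : ℕ} (a : Reg n t → ℂ) (α : Bits n → ℕ) : ℂ :=
  ∑ x with occurrences x = α, a x

theorem sum_occurrences {n t : ℕ} (x : Reg n t) : ∑ i, occurrences x i = t := by
  have := card_eq_sum_card_fiberwise (s := univ) (t := univ) (f := x) (by simp)
  simpa [occurrences] using this.symm

theorem sum_eq_of_wordCoeff_ne_zero {n t : ℕ} (a : Reg n t → ℂ) (α : Bits n → ℕ)
    (h : wordCoeff a α ≠ 0) : ∑ i, α i = t := by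
  obtain ⟨x, hx, -⟩ := exists_ne_zero_of_sum_ne_zero h
  rw [← (mem_filter.1 hx).2, sum_occurrences]

theorem sum_word_eq_polyVal {n t : ℕ} (a : Reg n t → ℂ) (ψ : PureState n) :
    ∑ x, a x * ∏ j, ψ.1 (x j) = polyVal n t (wordCoeff a) ψ := by
  rw [polyVal, ← sum_fiberwise_of_maps_to
    (g := fun x : Reg n t => occurrences x) (t := Fintype.piFinset fun _ => range (t + 1))]
  · refine sum_congr rfl fun α _ => ?_
    rw [wordCoeff, sum_mul]
    refine sum_congr rfl fun x hx => ?_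
    rw [← (mem_filter.1 hx).2, ← prod_fiberwise univ x]
    congr 1
    refine prod_congr rfl fun i _ => ?_
    rw [occurrences, ← prod_const]
    exact prod_congr rfl fun j hj => by rw [(mem_filter.1 hj).2]
  · intro x _
    simp only [Fintype.mem_piFinset, mem_range, Nat.lt_succ_iff]
    intro i
    exact (single_le_sum (f := occurrences x) (fun _ _ => Nat.zero_le _) (mem_univ i)).trans_eq
      (sum_occurrences x)

/-- `|ψ⟩⟨ψ|^{⊗t}` has rank one, so the trace is `‖C ψ^{⊗t}‖²`. Each coordinate of `C ψ^{⊗t}` is a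
polynomial of degree `t` in the amplitudes, with coefficients from a row of `C`. -/
theorem trace_mul_tensorPow_ketbra {n t : ℕ} (C : Matrix (Reg n t) (Reg n t) ℂ)
    (ψ : PureState n) :
    ((Cᴴ * C) * tensorPow t (ketbra ψ)).trace =
      ∑ k, ((‖polyVal n t (wordCoeff (C k)) ψ‖ ^ 2 : ℝ) : ℂ) := by
  have h : tensorPow t (ketbra ψ) =
      vecMulVec (fun x : Reg n t => ∏ j, ψ.1 (x j)) (star fun x : Reg n t => ∏ j, ψ.1 (x j)) := by
    ext x y
    simp [tensorPow, ketbra, vecMulVec_apply, prod_mul_distrib]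
  rw [h, Matrix.mul_assoc, trace_mul_comm, mul_vecMulVec, vecMulVec_mul, trace_vecMulVec]
  refine sum_congr rfl fun k _ => ?_
  rw [ofReal_norm_sq, ← sum_word_eq_polyVal]
  simp only [mulVec, vecMul, dotProduct, map_sum, map_mul, map_prod]
  congr 1
  refine sum_congr rfl fun x _ => ?_
  simp [conjTranspose_apply, mul_comm]

theorem trace_mul_matrixExp {Ω κ : Type} [MeasurableSpace Ω] [Fintype κ] (μ : Measure Ω)
    (M : Matrix κ κ ℂ) (F : Ω → Matrix κ κ ℂ) (hF : ∀ x y, Integrable (fun ω => F ω x y) μ) :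
    (M * matrixExp μ F).trace = ∫ ω, (M * F ω).trace ∂μ := by
  simp only [trace, diag_apply, mul_apply, matrixExp, of_apply]
  rw [integral_finsetSum _ fun x _ => integrable_finsetSum _ fun y _ =>
    (hF y x).const_mul (M x y)]
  refine sum_congr rfl fun x _ => ?_
  rw [integral_finsetSum _ fun y _ => (hF y x).const_mul (M x y)]
  exact sum_congr rfl fun y _ => (integral_const_mul _ _).symm

theorem continuous_tensorPow_ketbra {n t : ℕ} (x y : Reg n t) :
    Continuous fun ψ : PureState n => tensorPow t (ketbra ψ) x y := by
  simp only [tensorPow, ketbra, vecMulVec_apply, of_apply, Pi.star_apply]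
  fun_prop

theorem trace_kronecker_mul_identicalHaar {n t : ℕ} (A B : Matrix (Reg n t) (Reg n t) ℂ) :
    ((A ⊗ₖ B) * identicalHaar n t).trace =
      ∫ ψ, (A * tensorPow t (ketbra ψ)).trace * (B * tensorPow t (ketbra ψ)).trace
        ∂haarState n := by
  rw [identicalHaar, trace_mul_matrixExp]
  · simp_rw [← mul_kronecker_mul, trace_kronecker]
  · intro x y
    exact integrable_haarState
      ((continuous_tensorPow_ketbra _ _).mul (continuous_tensorPow_ketbra _ _))

theorem trace_kronecker_mul_independentHaar {n t : ℕ} (A B : Matrix (Reg n t) (Reg n t) ℂ) :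
    ((A ⊗ₖ B) * independentHaar n t).trace =
      (∫ ψ, (A * tensorPow t (ketbra ψ)).trace ∂haarState n) *
        ∫ ψ, (B * tensorPow t (ketbra ψ)).trace ∂haarState n := by
  have h : ∀ x y : Reg n t, Integrable (fun ψ => tensorPow t (ketbra ψ) x y) (haarState n) :=
    fun x y => integrable_haarState (continuous_tensorPow_ketbra x y)
  rw [independentHaar, ← mul_kronecker_mul, trace_kronecker, trace_mul_matrixExp _ _ _ h,
    trace_mul_matrixExp _ _ _ h]

theorem trace_tensorPow_ketbra {n : ℕ} (t : ℕ) (ψ : PureState n) :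
    (tensorPow t (ketbra ψ)).trace = 1 := by
  have h1 : ∑ i, ketbra ψ i i = 1 := by
    have h2 : ‖ψ.1‖ = 1 := mem_sphere_zero_iff_norm.1 ψ.2
    have h3 := EuclideanSpace.norm_sq_eq ψ.1
    rw [h2, one_pow] at h3
    rw [← Complex.ofReal_one, h3, Complex.ofReal_sum]
    exact sum_congr rfl fun i _ => (ofReal_norm_sq (ψ.1 i)).symm
  simp only [trace, diag_apply, tensorPow, of_apply]
  rw [← Fintype.piFinset_univ, ← prod_univ_sum (fun _ => univ) fun _ i => ketbra ψ i i]
  simp [h1]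

theorem trace_identicalHaar (n t : ℕ) : (identicalHaar n t).trace = 1 := by
  have := trace_kronecker_mul_identicalHaar (n := n) (t := t) 1 1
  simpa [trace_tensorPow_ketbra] using this

theorem trace_independentHaar (n t : ℕ) : (independentHaar n t).trace = 1 := by
  have := trace_kronecker_mul_independentHaar (n := n) (t := t) 1 1
  simpa [trace_tensorPow_ketbra] using this

theorem integral_trace_mul_tensorPow {n t : ℕ} (C : Matrix (Reg n t) (Reg n t) ℂ) :
    ∫ ψ, ((Cᴴ * C) * tensorPow t (ketbra ψ)).trace ∂haarState n =
      ((haarWeight n t * ∑ k, fockSq n t (wordCoeff (C k)) : ℝ) : ℂ) := by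
  have hc : ∀ k, Continuous fun ψ : PureState n =>
      ((‖polyVal n t (wordCoeff (C k)) ψ‖ ^ 2 : ℝ) : ℂ) := fun k =>
    Complex.continuous_ofReal.comp ((continuous_polyVal n t _).norm.pow 2)
  simp_rw [trace_mul_tensorPow_ketbra]
  rw [integral_finsetSum _ fun k _ => integrable_haarState (hc k)]
  simp_rw [fun k => integral_norm_polyVal_sq n t (wordCoeff (C k))
    (sum_eq_of_wordCoeff_ne_zero (C k))]
  rw [← Complex.ofReal_sum, mul_sum]

theorem le_re_integral_trace_mul_trace {n t : ℕ} (C C' : Matrix (Reg n t) (Reg n t) ℂ) :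
    haarWeight n (2 * t) * ((∑ k, fockSq n t (wordCoeff (C k))) *
        ∑ k, fockSq n t (wordCoeff (C' k))) ≤
      (∫ ψ, ((Cᴴ * C) * tensorPow t (ketbra ψ)).trace *
        ((C'ᴴ * C') * tensorPow t (ketbra ψ)).trace ∂haarState n).re := by
  have hc : ∀ k l, Continuous fun ψ : PureState n =>
      ((‖polyVal n t (wordCoeff (C k)) ψ‖ ^ 2 : ℝ) : ℂ) *
        ((‖polyVal n t (wordCoeff (C' l)) ψ‖ ^ 2 : ℝ) : ℂ) := fun k l =>
    (Complex.continuous_ofReal.comp ((continuous_polyVal n t _).norm.pow 2)).mul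
      (Complex.continuous_ofReal.comp ((continuous_polyVal n t _).norm.pow 2))
  simp_rw [trace_mul_tensorPow_ketbra, sum_mul_sum]
  rw [integral_finsetSum _ fun k _ => integrable_finsetSum _ fun l _ =>
    integrable_haarState (hc k l), Complex.re_sum, mul_sum]
  refine sum_le_sum fun k _ => ?_
  rw [integral_finsetSum _ fun l _ => integrable_haarState (hc k l), Complex.re_sum, mul_sum]
  exact sum_le_sum fun l _ => fockSq_mul_fockSq_le n t _ _
    (sum_eq_of_wordCoeff_ne_zero (C k)) (sum_eq_of_wordCoeff_ne_zero (C' l))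

open scoped MatrixOrder in
theorem _root_.Matrix.PosSemidef.exists_eq_conjTranspose_mul_self {κ : Type} [Fintype κ]
    [DecidableEq κ] {A : Matrix κ κ ℂ} (hA : A.PosSemidef) : ∃ C : Matrix κ κ ℂ, A = Cᴴ * C :=
  CStarAlgebra.nonneg_iff_eq_star_mul_self.mp hA.nonneg

theorem blockPos_independentHaar (n t : ℕ) : BlockPos (independentHaar n t) := by
  intro A B hA hB
  obtain ⟨C, rfl⟩ := hA.exists_eq_conjTranspose_mul_self
  obtain ⟨C', rfl⟩ := hB.exists_eq_conjTranspose_mul_self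
  rw [trace_kronecker_mul_independentHaar, integral_trace_mul_tensorPow,
    integral_trace_mul_tensorPow, ← Complex.ofReal_mul, Complex.ofReal_re]
  have h := haarWeight_nonneg n t
  have h' : ∀ C : Matrix (Reg n t) (Reg n t) ℂ, 0 ≤ ∑ k, fockSq n t (wordCoeff (C k)) :=
    fun C => sum_nonneg fun k _ => fockSq_nonneg n t _
  exact mul_nonneg (mul_nonneg h (h' C)) (mul_nonneg h (h' C'))

/-- Both traces are expressed by the same Fock norms, with weight `w(2t)` for identical states (as a
lower bound) and `w(t)²` for independent ones (exactly). Comparing the weights finishes. -/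
theorem blockPos_identicalHaar_sub (n t : ℕ) :
    BlockPos (identicalHaar n t - (1 - (t : ℝ) ^ 2 / 2 ^ n) • independentHaar n t) := by
  intro A B hA hB
  obtain ⟨C, rfl⟩ := hA.exists_eq_conjTranspose_mul_self
  obtain ⟨C', rfl⟩ := hB.exists_eq_conjTranspose_mul_self
  rw [Matrix.mul_sub, Matrix.mul_smul, trace_sub, trace_smul, trace_kronecker_mul_identicalHaar,
    trace_kronecker_mul_independentHaar, integral_trace_mul_tensorPow,
    integral_trace_mul_tensorPow, ← Complex.ofReal_mul, Complex.sub_re, Complex.smul_re,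
    Complex.ofReal_re, smul_eq_mul, sub_nonneg]
  refine le_trans ?_ (le_re_integral_trace_mul_trace C C')
  have h' : ∀ C : Matrix (Reg n t) (Reg n t) ℂ, 0 ≤ ∑ k, fockSq n t (wordCoeff (C k)) :=
    fun C => sum_nonneg fun k _ => fockSq_nonneg n t _
  have := mul_le_mul_of_nonneg_right (haarWeight_two_mul n t) (mul_nonneg (h' C) (h' C'))
  refine le_trans (le_of_eq ?_) this
  ring

end HaarInequality

end LOCCHaar

end

theorem mainTheorem1 :
    ∃ C : ℝ, 0 < C ∧ ∀ n t : ℕ,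
      LOCCHaar.LOCCIndistinguishable (C * ((t : ℝ) ^ 2 / (2 : ℝ) ^ n))
        (LOCCHaar.identicalHaar n t) (LOCCHaar.independentHaar n t) := by
  refine ⟨1, one_pos, fun n t => ?_⟩
  rw [one_mul]
  exact LOCCHaar.LOCCIndistinguishable.of_blockPos (by positivity)
    (LOCCHaar.trace_identicalHaar n t) (LOCCHaar.trace_independentHaar n t)
    (LOCCHaar.blockPos_independentHaar n t) (LOCCHaar.blockPos_identicalHaar_sub n t)
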